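/- Let $N\ge 1$ be an integer and $s\in(0,1)$. Let $G(t)=\int_0^t g(r)\,dr$ ($t\ge 0$) be a Young function, i.e. $g:[0,\infty)\to[0,\infty)$ is right continuous, $g(0)=0$, $g(t)>0$ for $t>0$, $g$ is non-decreasing on $(0,\infty)$ and $\lim_{t\to\infty}g(t)=\infty$. Assume that $G\in C^1([0,\infty))$ and that there are real numbers $p^-,p^+$ with $$1\le p^-\le \frac{t\,g(t)}{G(t)}\le p^+<\infty\qquad\text{for all } t>0 .$$ For $\Omega\subseteq\mathbb R^N$ measurable and $u$ measurable put $$\Phi_{G,\Omega}(u)=\int_\Omega G(|u(x)|)\,dx,\qquad \Phi_{s,G,\Omega}(u)=\iint_{\Omega\times\Omega}G\!\left(\frac{|u(x)-u(y)|}{|x-y|^s}\right)\frac{dx\,dy}{|x-y|^N}.$$ Let $L^G(\Omega)$ be the set of measurable $u$ on $\Omega$ with $\Phi_{G,\Omega}(\lambda u)<\infty$ for some $\lambda>0$, with the Luxemburg norm $\|u\|_{L^G(\Omega)}=\inf\{\lambda>0:\Phi_{G,\Omega}(u/\lambda)\le 1\}$, and let $W^{s,G}(\mathbb R^N)$ be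 the set of $u\in L^G(\mathbb R^N)$ with $\Phi_{s,G,\mathbb R^N}(\lambda u)<\infty$ for some $\lambda>0$. Let $(u_n)\subset W^{s,G}(\mathbb R^N)$ be such that $\Phi_{s,G,\mathbb R^N}(u_n)\le M$ for all $n$, with a finite constant $M$ independent of $n$, and suppose that there are $\tau,\delta>0$ such that the Lebesgue measure satisfies $$\operatorname{mes}\big(\{x\in\mathbb R^N: |u_n(x)|>\tau\}\big)\ge\delta\qquad\text{for all } n\in\mathbb N .$$ Then there is a sequence $(y_n)\subset\mathbb Z^N$ such that the sequence $v_n(x)=u_n(x+y_n)$ has a subsequence that converges in $L^G_{loc}(\mathbb R^N)$ to a function $v\in L^G_{loc}(\mathbb R^N)$ that is non-trivial (not equal to $0$ almost everywhere); that is, along the subsequence, $\|v_n-v\|_{L^G(K)}\to 0$ for every compact $K\subset\mathbb R^N$. -/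

import Mathlib

open MeasureTheory Set Filter Topology
open scoped ENNReal

noncomputable section

/-- `G` is a Young function with density `g`: for `t ≥ 0`, `G t = ∫₀ᵗ g`, where `g` is right
continuous on `[0, ∞)`, `g 0 = 0`, `g > 0` and non-decreasing on `(0, ∞)`, and `g t → ∞` as
`t → ∞`.  Only the values of `G` and `g` on `[0, ∞)` matter. -/
structure IsYoungFunction (G g : ℝ → ℝ) : Prop where
  integral_eq : ∀ t, 0 ≤ t → G t = ∫ r in (0 : ℝ)..t, g r
  right_continuous : ∀ t, 0 ≤ t → ContinuousWithinAt g (Ici t) t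
  map_zero : g 0 = 0
  pos : ∀ t, 0 < t → 0 < g t
  monotone : MonotoneOn g (Ioi 0)
  tendsto_atTop : Tendsto g atTop atTop

/-- The growth condition `1 ≤ p⁻ ≤ t g(t) / G(t) ≤ p⁺ < ∞` for all `t > 0`. -/
def GrowthCondition (G g : ℝ → ℝ) (pm pp : ℝ) : Prop :=
  1 ≤ pm ∧ ∀ t, 0 < t → pm ≤ t * g t / G t ∧ t * g t / G t ≤ pp

variable {N : ℕ}

/-- The modular `Φ_{G,Ω}(u) = ∫_Ω G(|u(x)|) dx`, with values in `[0, ∞]`. -/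
def orliczModular (G : ℝ → ℝ) (Ω : Set (EuclideanSpace ℝ (Fin N)))
    (u : EuclideanSpace ℝ (Fin N) → ℝ) : ℝ≥0∞ :=
  ∫⁻ x in Ω, ENNReal.ofReal (G |u x|)

/-- The `s`-Hölder quotient `D_s u(x, y) = (u(x) - u(y)) / |x - y|^s`. -/
def holderQuotient (s : ℝ) (u : EuclideanSpace ℝ (Fin N) → ℝ)
    (x y : EuclideanSpace ℝ (Fin N)) : ℝ :=
  (u x - u y) / ‖x - y‖ ^ s

/-- The Gagliardo modular `Φ_{s,G,Ω}(u) = ∬_{Ω×Ω} G(|D_s u(x,y)|) dx dy / |x - y|^N`, with values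
in `[0, ∞]`. -/
def gagliardoModular (s : ℝ) (G : ℝ → ℝ) (Ω : Set (EuclideanSpace ℝ (Fin N)))
    (u : EuclideanSpace ℝ (Fin N) → ℝ) : ℝ≥0∞ :=
  ∫⁻ x in Ω, ∫⁻ y in Ω,
    ENNReal.ofReal (G |holderQuotient s u x y|) / ENNReal.ofReal (‖x - y‖ ^ N)

/-- The Orlicz space `L^G(Ω)`: Lebesgue measurable functions `u` on `Ω` with
`Φ_{G,Ω}(c u) < ∞` for some `c > 0`. -/
def MemOrlicz (G : ℝ → ℝ) (Ω : Set (EuclideanSpace ℝ (Fin N)))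
    (u : EuclideanSpace ℝ (Fin N) → ℝ) : Prop :=
  AEMeasurable u (volume.restrict Ω) ∧ ∃ c : ℝ, 0 < c ∧ orliczModular G Ω (fun x => c * u x) < ∞

/-- The fractional Orlicz-Sobolev space `W^{s,G}(Ω)`. -/
def MemFracOrliczSobolev (s : ℝ) (G : ℝ → ℝ) (Ω : Set (EuclideanSpace ℝ (Fin N)))
    (u : EuclideanSpace ℝ (Fin N) → ℝ) : Prop :=
  MemOrlicz G Ω u ∧ ∃ c : ℝ, 0 < c ∧ gagliardoModular s G Ω (fun x => c * u x) < ∞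

/-- The Luxemburg norm `‖u‖_{L^G(Ω)} = inf {c > 0 : Φ_{G,Ω}(u / c) ≤ 1}`, with values in
`[0, ∞]`; it is `∞` if there is no such `c`. -/
def luxemburgNorm (G : ℝ → ℝ) (Ω : Set (EuclideanSpace ℝ (Fin N)))
    (u : EuclideanSpace ℝ (Fin N) → ℝ) : ℝ≥0∞ :=
  ⨅ (c : ℝ) (_ : 0 < c) (_ : orliczModular G Ω (fun x => u x / c) ≤ 1), ENNReal.ofReal c

/-- `L^G_loc(ℝ^N)`: functions that belong to `L^G(K)` for every compact `K`. -/
def MemOrliczLoc (G : ℝ → ℝ) (u : EuclideanSpace ℝ (Fin N) → ℝ) : Prop :=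
  ∀ K : Set (EuclideanSpace ℝ (Fin N)), IsCompact K → MemOrlicz G K u

/-- Convergence `w_k → v` in `L^G_loc(ℝ^N)`: all functions are in `L^G_loc(ℝ^N)` and
`‖w_k - v‖_{L^G(K)} → 0` for every compact `K`. -/
def TendstoOrliczLoc (G : ℝ → ℝ) (w : ℕ → EuclideanSpace ℝ (Fin N) → ℝ)
    (v : EuclideanSpace ℝ (Fin N) → ℝ) : Prop :=
  (∀ k, MemOrliczLoc G (w k)) ∧ MemOrliczLoc G v ∧
    ∀ K : Set (EuclideanSpace ℝ (Fin N)), IsCompact K →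
      Tendsto (fun k => luxemburgNorm G K (fun x => w k x - v x)) atTop (𝓝 0)

/-- The point of `ℝ^N` with integer coordinates `y`. -/
def latticePoint (y : Fin N → ℤ) : EuclideanSpace ℝ (Fin N) :=
  WithLp.toLp 2 (fun i => (y i : ℝ))

end

/-! Write `H t = G |t|`, a convex function that is doubling because of the growth condition. Cut
space into cubes of small side `h`. If no cube were more than half filled by `{|u_n| > τ/2}`, every
point with `|u_n| > τ` would see half a cube across a jump of at least `τ/2`, and the Gagliardo
modular would exceed `M`. So some cube is more than half full. Since `u_n` lies in `L^G`, only
finitely many cubes are at least half full, so there is one whose neighbour is at least half empty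
(`exists_extremal_cell`). Translate this pair near the origin (`exists_translation`).

Both cubes matter. No bound on the `L^G` norms is given, so the functions could be huge constants
near a full cube; the half-empty neighbour excludes this, because a fractional Poincaré inequality
then bounds the modular on every ball (`exists_modular_ball_le`). The full cube keeps the limit from
vanishing (`not_ae_eq_zero_of_tendsto`).

Compactness comes from cell averages: by Jensen they approximate the functions in modular, uniformly
in `n`, as the side tends to `0` (`modular_sub_cellAverage_le`), and on a ball they form finitely
many bounded real sequences. This gives a subsequence that is Cauchy in modular on balls.
Borel-Cantelli and Fatou provide its limit, and doubling turns modular convergence into norm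
convergence. -/

/-- Even, continuous, convex functions `H` with `H 0 = 0`, `H > 0` off `0` and `H (2 t) ≤ C H t`. -/
structure OrliczIntegrand (H : ℝ → ℝ) : Prop where
  continuous : Continuous H
  map_zero : H 0 = 0
  mono : ∀ a b, |a| ≤ |b| → H a ≤ H b
  convex : ConvexOn ℝ univ H
  pos : ∀ t, t ≠ 0 → 0 < H t
  doubling : ∃ C, 0 ≤ C ∧ ∀ t, H (2 * t) ≤ C * H t

/-! ### Convexity and doubling of the Young function. -/

namespace IsYoungFunction

variable {G g : ℝ → ℝ}

lemma monotoneOn_Ici (hG : IsYoungFunction G g) : MonotoneOn g (Ici 0) := by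
  intro a ha b hb hab
  rcases eq_or_lt_of_le (show (0 : ℝ) ≤ a from ha) with h | h
  · subst h
    rcases eq_or_lt_of_le (show (0 : ℝ) ≤ b from hb) with h | h
    · rw [← h]
    · rw [hG.map_zero]; exact (hG.pos b h).le
  · exact hG.monotone h (h.trans_le hab) hab

lemma intervalIntegrable (hG : IsYoungFunction G g) {a b : ℝ} (ha : 0 ≤ a) (hb : 0 ≤ b) :
    IntervalIntegrable g volume a b := by
  apply MonotoneOn.intervalIntegrable
  apply hG.monotoneOn_Ici.mono
  intro x hx
  exact (le_min ha hb).trans hx.1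

lemma sub_eq (hG : IsYoungFunction G g) {a b : ℝ} (ha : 0 ≤ a) (hb : 0 ≤ b) :
    G b - G a = ∫ r in a..b, g r := by
  rw [hG.integral_eq b hb, hG.integral_eq a ha]
  exact intervalIntegral.integral_interval_sub_left (hG.intervalIntegrable le_rfl hb)
    (hG.intervalIntegrable le_rfl ha)

lemma mul_le_sub (hG : IsYoungFunction G g) {a b : ℝ} (ha : 0 ≤ a) (hab : a ≤ b) :
    (b - a) * g a ≤ G b - G a := by
  rw [hG.sub_eq ha (ha.trans hab)]
  have := intervalIntegral.integral_mono_on hab (intervalIntegrable_const (c := g a))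
    (hG.intervalIntegrable ha (ha.trans hab))
    (fun x hx => hG.monotoneOn_Ici ha (ha.trans hx.1) hx.1)
  simpa using this

lemma sub_le_mul (hG : IsYoungFunction G g) {a b : ℝ} (ha : 0 ≤ a) (hab : a ≤ b) :
    G b - G a ≤ (b - a) * g b := by
  rw [hG.sub_eq ha (ha.trans hab)]
  have := intervalIntegral.integral_mono_on hab
    (hG.intervalIntegrable ha (ha.trans hab)) (intervalIntegrable_const (c := g b))
    (fun x hx => hG.monotoneOn_Ici (ha.trans hx.1) (ha.trans hab) hx.2)
  simpa using this

lemma integral_zero (hG : IsYoungFunction G g) : G 0 = 0 := by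
  simp [hG.integral_eq 0 le_rfl]

lemma nonneg_density (hG : IsYoungFunction G g) {t : ℝ} (ht : 0 ≤ t) : 0 ≤ g t := by
  have := hG.monotoneOn_Ici (mem_Ici.2 le_rfl) (mem_Ici.2 ht) ht
  rwa [hG.map_zero] at this

lemma monotoneOn_integral (hG : IsYoungFunction G g) : MonotoneOn G (Ici 0) := by
  intro a ha b hb hab
  have := hG.mul_le_sub ha hab
  nlinarith [mul_nonneg (sub_nonneg.2 hab) (hG.nonneg_density ha)]

lemma integral_pos (hG : IsYoungFunction G g) {t : ℝ} (ht : 0 < t) : 0 < G t := by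
  have h1 := hG.mul_le_sub (a := t / 2) (b := t) (by linarith) (by linarith)
  have h2 := hG.monotoneOn_integral (mem_Ici.2 le_rfl) (mem_Ici.2 (by linarith : 0 ≤ t / 2))
    (by linarith)
  rw [hG.integral_zero] at h2
  have := mul_pos (half_pos ht) (hG.pos (t / 2) (half_pos ht))
  nlinarith

/-- The value `g y` separates the slopes to the left and to the right of `y`. -/
lemma convexOn (hG : IsYoungFunction G g) : ConvexOn ℝ (Ici 0) G := by
  refine convexOn_of_slope_mono_adjacent (convex_Ici 0) ?_
  intro x y z hx hz hxy hyz
  have hy : 0 ≤ y := le_trans hx hxy.le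
  refine le_trans (b := g y) ?_ ?_
  · rw [div_le_iff₀ (by linarith)]
    linarith [hG.sub_le_mul hx hxy.le]
  · rw [le_div_iff₀ (by linarith)]
    linarith [hG.mul_le_sub hy hyz.le]

/-- With `q = 1 - 1/(2 p⁺)`, the drop `G r - G (q r)` is at most `(1 - q) r g(r) ≤ G r / 2`.
Shrinking the argument by `q` thus costs at most a factor `2`, and `m` such steps with `q ^ m < 1/2`
pass from `2t` below `t`. -/
lemma exists_doubling (hG : IsYoungFunction G g) {pm pp : ℝ} (hg : GrowthCondition G g pm pp) :
    ∃ C, 0 ≤ C ∧ ∀ t, 0 ≤ t → G (2 * t) ≤ C * G t := by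
  have hpp : 1 ≤ pp := hg.1.trans ((hg.2 1 one_pos).1.trans (hg.2 1 one_pos).2)
  set q : ℝ := 1 - 1 / (2 * pp) with hq
  have hq0 : 0 ≤ q := by
    have : 1 / (2 * pp) ≤ 1 := by rw [div_le_one (by linarith)]; linarith
    linarith
  have hq1 : q < 1 := by
    have : 0 < 1 / (2 * pp) := by positivity
    linarith
  have step : ∀ r, 0 ≤ r → G r ≤ 2 * G (q * r) := by
    intro r hr
    rcases eq_or_lt_of_le hr with h | h
    · subst h; simp [hG.integral_zero]
    have h1 := hG.sub_le_mul (a := q * r) (b := r) (by positivity) (by nlinarith)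
    have h2 := (hg.2 r h).2
    rw [div_le_iff₀ (hG.integral_pos h)] at h2
    have h3 : (r - q * r) * g r = (1 / (2 * pp)) * (r * g r) := by rw [hq]; ring
    have h4 : (1 / (2 * pp)) * (r * g r) ≤ (1 / (2 * pp)) * (pp * G r) :=
      mul_le_mul_of_nonneg_left h2 (by positivity)
    have h5 : (1 / (2 * pp)) * (pp * G r) = G r / 2 := by field_simp
    linarith
  have iter : ∀ (m : ℕ) (r : ℝ), 0 ≤ r → G r ≤ 2 ^ m * G (q ^ m * r) := by
    intro m
    induction m with
    | zero => intro r _; simp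
    | succ m ih =>
      intro r hr
      have h1 := ih r hr
      have h2 := step (q ^ m * r) (by positivity)
      have h3 : q * (q ^ m * r) = q ^ (m + 1) * r := by ring
      rw [h3] at h2
      calc G r ≤ 2 ^ m * G (q ^ m * r) := h1
        _ ≤ 2 ^ m * (2 * G (q ^ (m + 1) * r)) := by gcongr
        _ = _ := by ring
  obtain ⟨m, hm⟩ := exists_pow_lt_of_lt_one (show (0 : ℝ) < 1 / 2 by norm_num) hq1
  refine ⟨2 ^ m, by positivity, fun t ht => (iter m (2 * t) (by linarith)).trans ?_⟩
  gcongr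
  have : q ^ m * (2 * t) ≤ t := by nlinarith
  exact hG.monotoneOn_integral (mem_Ici.2 (by positivity)) ht this

lemma orliczIntegrand (hG : IsYoungFunction G g) (hc : ContinuousOn G (Ici 0)) {pm pp : ℝ}
    (hg : GrowthCondition G g pm pp) : OrliczIntegrand (fun t => G |t|) where
  continuous := hc.comp_continuous continuous_abs (fun x => abs_nonneg x)
  map_zero := by simp [hG.integral_zero]
  mono a b hab := hG.monotoneOn_integral (abs_nonneg a) (abs_nonneg b) hab
  convex := by
    refine ⟨convex_univ, fun x _ y _ a b ha hb hab => ?_⟩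
    refine le_trans ?_ (hG.convexOn.2 (abs_nonneg x) (abs_nonneg y) ha hb hab)
    refine hG.monotoneOn_integral (mem_Ici.2 (abs_nonneg _)) ?_ ?_
    · simp only [smul_eq_mul, mem_Ici]; positivity
    · simp only [smul_eq_mul]
      refine (abs_add_le _ _).trans ?_
      rw [abs_mul, abs_mul, abs_of_nonneg ha, abs_of_nonneg hb]
  pos t ht := hG.integral_pos (abs_pos.2 ht)
  doubling := by
    obtain ⟨C, hC, h⟩ := hG.exists_doubling hg
    refine ⟨C, hC, fun t => ?_⟩
    have := h |t| (abs_nonneg t)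
    rwa [← abs_two, ← abs_mul] at this

end IsYoungFunction

/-! ### Growth and scaling of doubling convex integrands. -/

namespace OrliczIntegrand

variable {H : ℝ → ℝ}

lemma nonneg (hH : OrliczIntegrand H) (t : ℝ) : 0 ≤ H t := by
  have := hH.mono 0 t (by simp)
  rwa [hH.map_zero] at this

lemma map_abs (hH : OrliczIntegrand H) (t : ℝ) : H |t| = H t :=
  le_antisymm (hH.mono _ _ (by simp)) (hH.mono _ _ (by simp))

lemma map_mul_le (hH : OrliczIntegrand H) {a : ℝ} (ha : 0 ≤ a) (ha1 : a ≤ 1) (t : ℝ) :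
    H (a * t) ≤ a * H t := by
  have := hH.convex.2 (mem_univ t) (mem_univ 0) ha (sub_nonneg.2 ha1) (by ring)
  simpa [hH.map_zero] using this

/-- Convexity and `H 0 = 0` force at least linear growth; both `H → ∞` and the control of `L¹` by
the modular rest on this. -/
lemma mul_map_one_le (hH : OrliczIntegrand H) {t : ℝ} (ht : 1 ≤ |t|) : |t| * H 1 ≤ H t := by
  have h0 : 0 < |t| := by linarith
  have h := hH.map_mul_le (inv_nonneg.2 h0.le) (inv_le_one_of_one_le₀ ht) |t|
  rw [inv_mul_cancel₀ h0.ne', hH.map_abs] at h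
  rwa [← div_eq_inv_mul, le_div_iff₀ h0, mul_comm] at h

lemma abs_le (hH : OrliczIntegrand H) (t : ℝ) : |t| ≤ 1 + (H 1)⁻¹ * H t := by
  have h1 := hH.pos 1 one_ne_zero
  have h2 := hH.nonneg t
  rcases le_total 1 |t| with h | h
  · have := hH.mul_map_one_le h
    have h3 : |t| ≤ (H 1)⁻¹ * H t := by
      rw [← div_eq_inv_mul, le_div_iff₀ h1]; exact this
    linarith
  · have : 0 ≤ (H 1)⁻¹ * H t := by positivity
    linarith

lemma exists_scaling (hH : OrliczIntegrand H) (a : ℝ) :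
    ∃ C, 0 ≤ C ∧ ∀ t, H (a * t) ≤ C * H t := by
  obtain ⟨C, hC, h⟩ := hH.doubling
  obtain ⟨m, hm⟩ := pow_unbounded_of_one_lt |a| (one_lt_two)
  have iter : ∀ (m : ℕ) (t : ℝ), H (2 ^ m * t) ≤ C ^ m * H t := by
    intro m
    induction m with
    | zero => intro t; simp
    | succ m ih =>
      intro t
      calc H (2 ^ (m + 1) * t) = H (2 * (2 ^ m * t)) := by ring_nf
        _ ≤ C * (C ^ m * H t) := (h _).trans (by gcongr; exact ih t)
        _ = _ := by ring
  refine ⟨C ^ m, by positivity, fun t => (hH.mono _ _ ?_).trans (iter m t)⟩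
  rw [abs_mul, abs_mul, abs_of_pos (show (0 : ℝ) < 2 ^ m by positivity)]
  gcongr

lemma exists_add_le (hH : OrliczIntegrand H) :
    ∃ C, 0 ≤ C ∧ ∀ a b, H (a + b) ≤ C * (H a + H b) := by
  obtain ⟨C, hC, h⟩ := hH.doubling
  refine ⟨C, hC, fun a b => ?_⟩
  rcases le_total |a| |b| with hab | hab
  · have h1 : H (a + b) ≤ H (2 * b) := hH.mono _ _ (by
      rw [abs_mul, abs_two]; linarith [abs_add_le a b])
    nlinarith [h b, mul_nonneg hC (hH.nonneg a)]
  · have h1 : H (a + b) ≤ H (2 * a) := hH.mono _ _ (by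
      rw [abs_mul, abs_two]; linarith [abs_add_le a b])
    nlinarith [h a, mul_nonneg hC (hH.nonneg b)]

lemma tendsto_atTop (hH : OrliczIntegrand H) : Tendsto H atTop atTop := by
  refine tendsto_atTop_mono' atTop ?_ (tendsto_id.atTop_mul_const (hH.pos 1 one_ne_zero))
  filter_upwards [eventually_ge_atTop 1] with t ht
  have := hH.mul_map_one_le (t := t) (by rwa [abs_of_nonneg (by linarith)])
  rwa [abs_of_nonneg (by linarith)] at this

end OrliczIntegrand

/-! ### Cubic cells and the extremal half-full cell. -/

section Cells

variable {N : ℕ}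

/-- The index of the half-open cube of side `h`, with vertices in `h ℤ^N`, that contains `x`. -/
noncomputable def cellIndex (h : ℝ) (x : EuclideanSpace ℝ (Fin N)) : Fin N → ℤ := fun i => ⌊x i / h⌋

/-- The half-open cube `h (z + [0, 1)^N)`. -/
noncomputable def cell (h : ℝ) (z : Fin N → ℤ) : Set (EuclideanSpace ℝ (Fin N)) := {x | cellIndex h x = z}

lemma measurable_cellIndex (h : ℝ) : Measurable (cellIndex (N := N) h) := by
  refine measurable_pi_iff.2 fun i => ?_
  have : Measurable fun x : EuclideanSpace ℝ (Fin N) => x i / h := by fun_prop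
  exact Int.measurable_floor.comp this

lemma measurableSet_cell (h : ℝ) (z : Fin N → ℤ) : MeasurableSet (cell h z) :=
  measurable_cellIndex h (measurableSet_singleton z)

lemma mem_cell_iff {h : ℝ} (hh : 0 < h) {z : Fin N → ℤ} {x : EuclideanSpace ℝ (Fin N)} :
    x ∈ cell h z ↔ ∀ i, h * z i ≤ x i ∧ x i < h * (z i + 1) := by
  simp only [cell, cellIndex, mem_ofPred_eq, funext_iff, Int.floor_eq_iff, le_div_iff₀ hh,
    div_lt_iff₀ hh, mul_comm h]

lemma volume_cell {h : ℝ} (hh : 0 < h) (z : Fin N → ℤ) :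
    volume (cell h z) = ENNReal.ofReal (h ^ N) := by
  have : cell h z = (WithLp.ofLp) ⁻¹'
      (Set.univ.pi fun i => Ico (h * z i : ℝ) (h * (z i + 1))) := by
    ext x
    simp [mem_cell_iff hh, Set.mem_pi]
  rw [this, (PiLp.volume_preserving_ofLp (Fin N)).measure_preimage
    (MeasurableSet.univ_pi fun i => measurableSet_Ico).nullMeasurableSet, Real.volume_pi_Ico]
  simp [mul_add, ENNReal.ofReal_pow hh.le]

lemma norm_le_mul_sqrt_of_abs_le {a : ℝ} (ha : 0 ≤ a) {x : EuclideanSpace ℝ (Fin N)}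
    (hx : ∀ i, |x i| ≤ a) : ‖x‖ ≤ a * √N := by
  rw [EuclideanSpace.norm_eq]
  apply Real.sqrt_le_iff.2 ⟨by positivity, ?_⟩
  calc ∑ i, ‖x i‖ ^ 2 ≤ ∑ _i : Fin N, a ^ 2 := by
        gcongr with i; exact hx i
    _ = (a * √N) ^ 2 := by
        rw [mul_pow, Real.sq_sqrt (by positivity)]; simp [mul_comm]

lemma norm_sub_le_of_mem_cell {h : ℝ} (hh : 0 < h) {z : Fin N → ℤ}
    {x y : EuclideanSpace ℝ (Fin N)} (hx : x ∈ cell h z) (hy : y ∈ cell h z) :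
    ‖x - y‖ ≤ h * √N := by
  rw [mem_cell_iff hh] at hx hy
  refine norm_le_mul_sqrt_of_abs_le hh.le fun i => ?_
  rw [PiLp.sub_apply, abs_le]
  constructor <;> nlinarith [hx i, hy i]

lemma finite_cellIndex_image {h : ℝ} (hh : 0 < h) {K : Set (EuclideanSpace ℝ (Fin N))}
    (hK : Bornology.IsBounded K) : (cellIndex h '' K).Finite := by
  obtain ⟨R, hR⟩ := hK.exists_norm_le
  refine (Set.Finite.pi' (t := fun _ : Fin N => Icc ⌊-R / h⌋ ⌊R / h⌋)
    fun i => finite_Icc _ _).subset ?_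
  rintro _ ⟨x, hx, rfl⟩ i
  have h1 := (PiLp.norm_apply_le x i).trans (hR x hx)
  rw [Real.norm_eq_abs, abs_le] at h1
  exact ⟨Int.floor_mono (by gcongr; exact h1.1), Int.floor_mono (by gcongr; exact h1.2)⟩

lemma isBounded_cell {h : ℝ} (hh : 0 < h) (z : Fin N → ℤ) : Bornology.IsBounded (cell h z) := by
  rw [Metric.isBounded_iff]
  exact ⟨h * √N, fun x hx y hy => by
    rw [dist_eq_norm]; exact norm_sub_le_of_mem_cell hh hx hy⟩

/-- Rounding the corner `h z` down to an integer point costs at most `1` per coordinate; the cell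
and its neighbour together extend at most `2h ≤ 2`. -/
lemma abs_apply_le_of_add_latticePoint_mem_cell {h : ℝ} (hh : 0 < h) (hh1 : h ≤ 1)
    {z z' : Fin N → ℤ} (hz : ∀ i, z i ≤ z' i ∧ z' i ≤ z i + 1) {x : EuclideanSpace ℝ (Fin N)}
    (hx : x + latticePoint (fun i => ⌊h * z i⌋) ∈ cell h z') (i : Fin N) : |x i| ≤ 3 := by
  have h1 := (mem_cell_iff hh).1 hx i
  simp only [PiLp.add_apply, latticePoint] at h1
  have h2 := Int.floor_le (h * z i)
  have h3 := Int.lt_floor_add_one (h * z i)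
  have h4 : (z i : ℝ) ≤ z' i := by exact_mod_cast (hz i).1
  have h5 : (z' i : ℝ) ≤ z i + 1 := by exact_mod_cast (hz i).2
  rw [abs_le]
  constructor <;> nlinarith

/-- If a set of finite measure occupies more than half of some cell, then this is so for a cell
one of whose neighbours it does not fill by more than half. -/
lemma exists_extremal_cell (hN : 1 ≤ N) {h : ℝ} (hh : 0 < h)
    {A : Set (EuclideanSpace ℝ (Fin N))} (hA : MeasurableSet A) (hfin : volume A ≠ ∞)
    (z₀ : Fin N → ℤ) (hz₀ : ENNReal.ofReal (h ^ N / 2) < volume (cell h z₀ ∩ A)) :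
    ∃ z z' : Fin N → ℤ, (∀ i, z i ≤ z' i ∧ z' i ≤ z i + 1) ∧
      ENNReal.ofReal (h ^ N / 2) ≤ volume (cell h z ∩ A) ∧
      ENNReal.ofReal (h ^ N / 2) ≤ volume (cell h z' \ A) := by
  have hpos : 0 < ENNReal.ofReal (h ^ N / 2) := ENNReal.ofReal_pos.2 (by positivity)
  have hS : {z : Fin N → ℤ | ENNReal.ofReal (h ^ N / 2) ≤ volume (cell h z ∩ A)}.Finite := by
    refine Measure.finite_const_le_meas_of_disjoint_iUnion volume hpos
      (fun z => (measurableSet_cell h z).inter hA) ?_ ?_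
    · intro z z' hne
      refine Set.disjoint_left.2 fun x hx hx' => hne ?_
      exact (show cellIndex h x = z from hx.1).symm.trans hx'.1
    · exact ne_top_of_le_ne_top hfin (measure_mono (iUnion_subset fun z => inter_subset_right))
  -- Among the finitely many cells that are at least half full, take one with the largest coordinate
  -- `i₀`; its successor in that direction cannot be half full.
  let i₀ : Fin N := ⟨0, hN⟩
  obtain ⟨z, hz, hmax⟩ := Set.exists_max_image _ (fun z : Fin N → ℤ => z i₀) hS ⟨z₀, hz₀.le⟩
  refine ⟨z, z + Pi.single i₀ 1, fun i => ?_, hz, ?_⟩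
  · by_cases hi : i = i₀
    · subst hi; simp
    · simp [Pi.single_eq_of_ne hi]
  · by_contra! hlt
    have h1 : volume (cell h (z + Pi.single i₀ 1) ∩ A) < ENNReal.ofReal (h ^ N / 2) := by
      by_contra! hge
      have := hmax _ hge
      simp at this
    have h2 := measure_inter_add_sdiff (μ := volume) (cell h (z + Pi.single i₀ 1)) hA
    rw [volume_cell hh] at h2
    have h3 := ENNReal.add_lt_add h1 hlt
    rw [h2, ← ENNReal.ofReal_add (by positivity) (by positivity), add_halves] at h3
    exact lt_irrefl _ h3

end Cells

/-! ### Lower bounds for the Gagliardo modular and a Poincaré inequality. -/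

section Gagliardo

variable {N : ℕ}

/-- The integrand of the Gagliardo modular. -/
noncomputable def gagliardoKernel (s : ℝ) (H : ℝ → ℝ) (u : EuclideanSpace ℝ (Fin N) → ℝ)
    (x y : EuclideanSpace ℝ (Fin N)) : ℝ≥0∞ :=
  ENNReal.ofReal (H (holderQuotient s u x y)) / ENNReal.ofReal (‖x - y‖ ^ N)

lemma gagliardoModular_univ (s : ℝ) (G : ℝ → ℝ) (u : EuclideanSpace ℝ (Fin N) → ℝ) :
    gagliardoModular s G univ u = ∫⁻ x, ∫⁻ y, gagliardoKernel s (fun t => G |t|) u x y := by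
  simp only [gagliardoModular, gagliardoKernel, Measure.restrict_univ]

variable {H : ℝ → ℝ} {s : ℝ}

lemma gagliardoKernel_eq {u : EuclideanSpace ℝ (Fin N) → ℝ} {x y : EuclideanSpace ℝ (Fin N)}
    (hxy : x ≠ y) : gagliardoKernel s H u x y =
      ENNReal.ofReal (H (holderQuotient s u x y) / ‖x - y‖ ^ N) := by
  have : 0 < ‖x - y‖ := norm_pos_iff.2 (sub_ne_zero.2 hxy)
  rw [gagliardoKernel, ENNReal.ofReal_div_of_pos (by positivity)]

/-- Both `|u x - u y| ≤ ρ^s |D_s u|` and `1 ≤ (ρ / |x - y|)^N` hold at distance at most `ρ`. The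
factor `κ` is left free: on large balls it comes from doubling, and for `ρ ≤ 1` convexity allows `κ
= ρ^s`, which is small. -/
lemma OrliczIntegrand.le_gagliardoKernel (hH : OrliczIntegrand H) (hs : 0 ≤ s) {ρ κ : ℝ}
    (hκ : 0 ≤ κ) (hscale : ∀ t, H (ρ ^ s * t) ≤ κ * H t) (u : EuclideanSpace ℝ (Fin N) → ℝ)
    {x y : EuclideanSpace ℝ (Fin N)} (hxy : ‖x - y‖ ≤ ρ) :
    ENNReal.ofReal (H (u x - u y)) ≤ ENNReal.ofReal (κ * ρ ^ N) * gagliardoKernel s H u x y := by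
  by_cases hne : x = y
  · subst hne; simp [hH.map_zero]
  have hd : 0 < ‖x - y‖ := norm_pos_iff.2 (sub_ne_zero.2 hne)
  have hρ : 0 < ρ := hd.trans_le hxy
  rw [gagliardoKernel_eq hne, ← ENNReal.ofReal_mul (by positivity)]
  apply ENNReal.ofReal_le_ofReal
  set D := holderQuotient s u x y with hD
  have h1 : u x - u y = ‖x - y‖ ^ s * D := by
    rw [hD, holderQuotient, mul_div_cancel₀ _ (Real.rpow_pos_of_pos hd s).ne']
  have h2 : H (u x - u y) ≤ κ * H D := by
    refine (hH.mono _ _ ?_).trans (hscale D)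
    rw [h1, abs_mul, abs_mul, abs_of_nonneg (Real.rpow_nonneg hd.le s),
      abs_of_nonneg (Real.rpow_nonneg hρ.le s)]
    gcongr
  have h3 : 1 ≤ ρ ^ N / ‖x - y‖ ^ N := by
    rw [one_le_div (by positivity)]; gcongr
  have h4 : 0 ≤ κ * H D := mul_nonneg hκ (hH.nonneg D)
  calc H (u x - u y) ≤ κ * H D := h2
    _ ≤ κ * H D * (ρ ^ N / ‖x - y‖ ^ N) := le_mul_of_one_le_right h4 h3
    _ = _ := by ring

/-- If the Gagliardo modular is small compared with the measure of `{|u| > τ}`, then some cell of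
side `h` is filled to more than a half by `{|u| > τ / 2}`. -/
lemma OrliczIntegrand.exists_cell_of_gagliardo_lt (hH : OrliczIntegrand H) (hs : 0 ≤ s)
    (hN : 1 ≤ N) {h τ : ℝ} (hh : 0 < h) (hτ : 0 < τ) {u : EuclideanSpace ℝ (Fin N) → ℝ}
    (hu : Measurable u)
    (hlt : ∫⁻ x, ∫⁻ y, gagliardoKernel s H u x y <
      ENNReal.ofReal (h ^ N / 2 * (H (τ / 2 / (h * √N) ^ s) / (h * √N) ^ N)) *
        volume {x | τ < |u x|}) :
    ∃ z, ENNReal.ofReal (h ^ N / 2) < volume (cell h z ∩ {x | τ / 2 < |u x|}) := by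
  by_contra! hsmall
  refine hlt.not_ge ?_
  have hN' : (0 : ℝ) < √N := Real.sqrt_pos.2 (by exact_mod_cast hN)
  set c : ℝ := H (τ / 2 / (h * √N) ^ s) / (h * √N) ^ N with hc
  have hA : MeasurableSet {x | τ / 2 < |u x|} := measurableSet_lt measurable_const hu.abs
  -- Within one cell, a point above `τ` and a point below `τ/2` differ by at least `τ/2` at distance
  -- at most the diameter `h √N`.
  have hker : ∀ x, τ < |u x| → ∀ y ∈ cell h (cellIndex h x) \ {x | τ / 2 < |u x|},
      ENNReal.ofReal c ≤ gagliardoKernel s H u x y := by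
    intro x hx y hy
    have hy2 : |u y| ≤ τ / 2 := not_lt.1 hy.2
    have hne : x ≠ y := by
      rintro rfl; linarith
    have hd : 0 < ‖x - y‖ := norm_pos_iff.2 (sub_ne_zero.2 hne)
    have hd2 : ‖x - y‖ ≤ h * √N := norm_sub_le_of_mem_cell hh (z := cellIndex h x) rfl hy.1
    rw [gagliardoKernel_eq hne]
    apply ENNReal.ofReal_le_ofReal
    refine div_le_div₀ (hH.nonneg _) (hH.mono _ _ ?_) (by positivity) (by gcongr)
    rw [holderQuotient, abs_div (τ / 2), abs_div (u x - u y), abs_of_nonneg (Real.rpow_nonneg hd.le s),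
      abs_of_nonneg (Real.rpow_nonneg (by positivity : 0 ≤ h * √N) s), abs_of_pos (half_pos hτ)]
    have : τ / 2 ≤ |u x - u y| := by linarith [abs_sub_abs_le_abs_sub (u x) (u y)]
    gcongr
  have hvol : ∀ z, ENNReal.ofReal (h ^ N / 2) ≤ volume (cell h z \ {x | τ / 2 < |u x|}) := by
    intro z
    by_contra! hlt'
    have h2 := measure_inter_add_sdiff (μ := volume) (cell h z) hA
    rw [volume_cell hh] at h2
    have h3 := ENNReal.add_lt_add_of_le_of_lt (ne_top_of_le_ne_top ENNReal.ofReal_ne_top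
      (hsmall z)) (hsmall z) hlt'
    rw [h2, ← ENNReal.ofReal_add (by positivity) (by positivity), add_halves] at h3
    exact lt_irrefl _ h3
  have hinner : ∀ x ∈ {x | τ < |u x|},
      ENNReal.ofReal (h ^ N / 2 * c) ≤ ∫⁻ y, gagliardoKernel s H u x y := by
    intro x hx
    rw [ENNReal.ofReal_mul (by positivity), mul_comm]
    calc ENNReal.ofReal c * ENNReal.ofReal (h ^ N / 2)
        ≤ ENNReal.ofReal c * volume (cell h (cellIndex h x) \ {x | τ / 2 < |u x|}) := by
          gcongr; exact hvol _
      _ = ∫⁻ _ in cell h (cellIndex h x) \ {x | τ / 2 < |u x|}, ENNReal.ofReal c := by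
          rw [setLIntegral_const]
      _ ≤ ∫⁻ y in cell h (cellIndex h x) \ {x | τ / 2 < |u x|}, gagliardoKernel s H u x y :=
          setLIntegral_mono' ((measurableSet_cell h _).diff hA) (hker x hx)
      _ ≤ _ := setLIntegral_le_lintegral _ _
  calc ENNReal.ofReal (h ^ N / 2 * c) * volume {x | τ < |u x|}
      = ∫⁻ _ in {x | τ < |u x|}, ENNReal.ofReal (h ^ N / 2 * c) := by rw [setLIntegral_const]
    _ ≤ ∫⁻ x in {x | τ < |u x|}, ∫⁻ y, gagliardoKernel s H u x y :=
        setLIntegral_mono' (measurableSet_lt measurable_const hu.abs) hinner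
    _ ≤ _ := setLIntegral_le_lintegral _ _

/-- The powers of `h` outside `H` cancel, which leaves a constant multiple of `H (τ / 2 / (h
√N)^s)`; this tends to `∞` as `h → 0`. -/
lemma OrliczIntegrand.exists_small_side (hH : OrliczIntegrand H) (hs : 0 < s) (hN : 1 ≤ N)
    {τ δ : ℝ} (hτ : 0 < τ) (hδ : 0 < δ) (M : ℝ) :
    ∃ h, 0 < h ∧ h ≤ 1 ∧ ENNReal.ofReal M <
      ENNReal.ofReal (h ^ N / 2 * (H (τ / 2 / (h * √N) ^ s) / (h * √N) ^ N)) *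
        ENNReal.ofReal δ := by
  have hN' : (0 : ℝ) < √N := Real.sqrt_pos.2 (by exact_mod_cast hN)
  have h1 : Tendsto (fun h : ℝ => (h * √N) ^ s) (𝓝[>] 0) (𝓝[>] 0) := by
    refine tendsto_nhdsWithin_iff.2 ⟨?_, ?_⟩
    · have : Continuous fun h : ℝ => (h * √N) ^ s :=
        (continuous_id.mul continuous_const).rpow_const fun _ => Or.inr hs.le
      have h0 := this.tendsto 0
      simp only [zero_mul, Real.zero_rpow hs.ne'] at h0
      exact h0.mono_left nhdsWithin_le_nhds
    · filter_upwards [self_mem_nhdsWithin] with h hh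
      exact Real.rpow_pos_of_pos (mul_pos hh hN') s
  have h2 : Tendsto (fun h : ℝ => H (τ / 2 / (h * √N) ^ s)) (𝓝[>] 0) atTop := by
    refine hH.tendsto_atTop.comp ?_
    simp only [div_eq_mul_inv (τ / 2)]
    exact (tendsto_inv_nhdsGT_zero.comp h1).const_mul_atTop (half_pos hτ)
  obtain ⟨h, hbig, hh0, hh1⟩ := ((h2.eventually_gt_atTop (2 * √N ^ N * (|M| + 1) / δ)).and
    (Ioc_mem_nhdsGT one_pos)).exists
  refine ⟨h, hh0, hh1, ?_⟩
  have hnn := hH.nonneg (τ / 2 / (h * √N) ^ s)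
  rw [← ENNReal.ofReal_mul (by have : 0 < h := hh0; positivity)]
  have heq : h ^ N / 2 * (H (τ / 2 / (h * √N) ^ s) / (h * √N) ^ N) * δ =
      H (τ / 2 / (h * √N) ^ s) * δ / (2 * √N ^ N) := by
    have : h ≠ 0 := (show 0 < h from hh0).ne'
    rw [mul_pow]; field_simp
  have hgt : |M| + 1 < H (τ / 2 / (h * √N) ^ s) * δ / (2 * √N ^ N) := by
    rw [div_lt_iff₀ hδ] at hbig
    rw [lt_div_iff₀ (by positivity)]
    linarith
  rw [heq]
  exact (ENNReal.ofReal_lt_ofReal_iff (by linarith [abs_nonneg M])).2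
    (by linarith [le_abs_self M])

/-- A fractional Poincaré inequality: the Gagliardo modular controls the modular on a ball, if
the function is bounded by `τ` on a non-negligible part of the ball. -/
lemma OrliczIntegrand.exists_modular_ball_le (hH : OrliczIntegrand H) (hs : 0 ≤ s) {M : ℝ≥0∞}
    (hM : M ≠ ∞) {ε : ℝ≥0∞} (hε : ε ≠ 0) (τ R : ℝ) :
    ∃ C : ℝ≥0∞, C ≠ ∞ ∧ ∀ v : EuclideanSpace ℝ (Fin N) → ℝ, Measurable v →
      ∫⁻ x, ∫⁻ y, gagliardoKernel s H v x y ≤ M →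
      ε ≤ volume (Metric.ball 0 R ∩ {x | |v x| ≤ τ}) →
      ∫⁻ x in Metric.ball 0 R, ENNReal.ofReal (H (v x)) ≤ C := by
  obtain ⟨C₁, hC₁, hadd⟩ := hH.exists_add_le
  obtain ⟨κ, hκ, hscale⟩ := hH.exists_scaling ((2 * R) ^ s)
  set B : Set (EuclideanSpace ℝ (Fin N)) := Metric.ball 0 R with hB
  have hBfin : volume B ≠ ∞ := measure_ball_lt_top.ne
  set c := ENNReal.ofReal (κ * (2 * R) ^ N)
  refine ⟨ENNReal.ofReal C₁ * (c * M + ENNReal.ofReal (H τ) * volume B * volume B) / ε,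
    ENNReal.div_ne_top (by finiteness) hε, fun v hvm hv hvol => ?_⟩
  have hεtop : ε ≠ ∞ := ne_top_of_le_ne_top hBfin (hvol.trans (measure_mono inter_subset_left))
  rw [ENNReal.le_div_iff_mul_le (Or.inl hε) (Or.inl hεtop)]
  set S := B ∩ {x | |v x| ≤ τ} with hS
  -- Split `v x = (v x - v y) + v y` with `|v y| ≤ τ`. Integrating over `y ∈ S`, whose measure is at
  -- least `ε`, and then over `x ∈ B` gives the bound.
  have hpt : ∀ x ∈ B, ∀ y ∈ S, ENNReal.ofReal (H (v x)) ≤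
      ENNReal.ofReal C₁ * (c * gagliardoKernel s H v x y + ENNReal.ofReal (H τ)) := by
    intro x hx y hy
    have hxy : ‖x - y‖ ≤ 2 * R := by
      have h1 := mem_ball_zero_iff.1 hx
      have h2 := mem_ball_zero_iff.1 hy.1
      linarith [norm_sub_le x y]
    have h1 := hadd (v x - v y) (v y)
    rw [sub_add_cancel] at h1
    calc ENNReal.ofReal (H (v x)) ≤ ENNReal.ofReal (C₁ * (H (v x - v y) + H (v y))) :=
          ENNReal.ofReal_le_ofReal h1
      _ = ENNReal.ofReal C₁ * (ENNReal.ofReal (H (v x - v y)) + ENNReal.ofReal (H (v y))) := by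
          rw [ENNReal.ofReal_mul hC₁, ENNReal.ofReal_add (hH.nonneg _) (hH.nonneg _)]
      _ ≤ _ := by
          gcongr
          · exact hH.le_gagliardoKernel hs hκ hscale v hxy
          · exact hH.mono _ _ ((show |v y| ≤ τ from hy.2).trans (le_abs_self τ))
  have hinner : ∀ x ∈ B, ENNReal.ofReal (H (v x)) * ε ≤
      ENNReal.ofReal C₁ * (c * (∫⁻ y, gagliardoKernel s H v x y) +
        ENNReal.ofReal (H τ) * volume B) := by
    intro x hx
    calc ENNReal.ofReal (H (v x)) * ε ≤ ENNReal.ofReal (H (v x)) * volume S := by gcongr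
      _ = ∫⁻ _ in S, ENNReal.ofReal (H (v x)) := by rw [setLIntegral_const]
      _ ≤ ∫⁻ y in S, ENNReal.ofReal C₁ *
            (c * gagliardoKernel s H v x y + ENNReal.ofReal (H τ)) :=
          setLIntegral_mono' (Metric.isOpen_ball.measurableSet.inter
            (measurableSet_le hvm.abs measurable_const)) (hpt x hx)
      _ ≤ ∫⁻ y in B, ENNReal.ofReal C₁ *
            (c * gagliardoKernel s H v x y + ENNReal.ofReal (H τ)) :=
          lintegral_mono_set inter_subset_left
      _ = ENNReal.ofReal C₁ * (c * (∫⁻ y in B, gagliardoKernel s H v x y) +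
            ENNReal.ofReal (H τ) * volume B) := by
          rw [lintegral_const_mul' _ _ ENNReal.ofReal_ne_top,
            lintegral_add_right _ measurable_const, lintegral_const_mul' _ _ ENNReal.ofReal_ne_top,
            setLIntegral_const]
      _ ≤ _ := by gcongr; exact Measure.restrict_le_self
  calc (∫⁻ x in B, ENNReal.ofReal (H (v x))) * ε
      = ∫⁻ x in B, ENNReal.ofReal (H (v x)) * ε := by rw [lintegral_mul_const' _ _ hεtop]
    _ ≤ ∫⁻ x in B, ENNReal.ofReal C₁ * (c * (∫⁻ y, gagliardoKernel s H v x y) +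
        ENNReal.ofReal (H τ) * volume B) := setLIntegral_mono' Metric.isOpen_ball.measurableSet hinner
    _ = ENNReal.ofReal C₁ * (c * (∫⁻ x in B, ∫⁻ y, gagliardoKernel s H v x y) +
        ENNReal.ofReal (H τ) * volume B * volume B) := by
          rw [lintegral_const_mul' _ _ ENNReal.ofReal_ne_top,
            lintegral_add_right _ measurable_const, lintegral_const_mul' _ _ ENNReal.ofReal_ne_top,
            setLIntegral_const]
    _ ≤ _ := by
        gcongr
        exact (setLIntegral_le_lintegral _ _).trans hv

end Gagliardo

/-! ### Compactness through cell averages, and completeness. -/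

section Compactness

variable {N : ℕ} {H : ℝ → ℝ} {s : ℝ}

lemma OrliczIntegrand.exists_ofReal_add_le (hH : OrliczIntegrand H) :
    ∃ C : ℝ≥0∞, C ≠ ∞ ∧ ∀ a b, ENNReal.ofReal (H (a + b)) ≤
      C * (ENNReal.ofReal (H a) + ENNReal.ofReal (H b)) := by
  obtain ⟨C, hC, h⟩ := hH.exists_add_le
  refine ⟨ENNReal.ofReal C, ENNReal.ofReal_ne_top, fun a b => ?_⟩
  rw [← ENNReal.ofReal_add (hH.nonneg _) (hH.nonneg _), ← ENNReal.ofReal_mul hC]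
  exact ENNReal.ofReal_le_ofReal (h a b)

lemma OrliczIntegrand.measurable_ofReal_comp (hH : OrliczIntegrand H) {α : Type*}
    [MeasurableSpace α] {f : α → ℝ} (hf : Measurable f) :
    Measurable fun x => ENNReal.ofReal (H (f x)) :=
  (hH.continuous.measurable.comp hf).ennreal_ofReal

/-- Jensen's inequality for the average over a set of finite positive measure. -/
lemma OrliczIntegrand.ofReal_map_sub_average_le (hH : OrliczIntegrand H) {α : Type*}
    [MeasurableSpace α] {μ : Measure α} {q : Set α} (hq0 : μ q ≠ 0) (hq : μ q ≠ ∞) {f : α → ℝ}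
    (hf : Measurable f) (hfi : IntegrableOn f q μ) (c : ℝ) :
    ENNReal.ofReal (H (c - ⨍ y in q, f y ∂μ)) ≤
      (μ q)⁻¹ * ∫⁻ y in q, ENNReal.ofReal (H (c - f y)) ∂μ := by
  -- An infinite right-hand side is trivial; a finite one supplies the integrability that Jensen's
  -- inequality needs.
  by_cases htop : ∫⁻ y in q, ENNReal.ofReal (H (c - f y)) ∂μ = ∞
  · rw [htop, ENNReal.mul_top (ENNReal.inv_ne_zero.2 hq)]; exact le_top
  have : IsFiniteMeasure (μ.restrict q) := ⟨by simpa using hq.lt_top⟩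
  have hHi : IntegrableOn (fun y => H (c - f y)) q μ :=
    (lintegral_ofReal_ne_top_iff_integrable
      (hH.continuous.measurable.comp (measurable_const.sub hf)).aestronglyMeasurable
      (ae_of_all _ fun y => hH.nonneg _)).1 htop
  have hci : IntegrableOn (fun y => c - f y) q μ := (integrable_const c).sub hfi
  have h1 := hH.convex.map_set_average_le hH.continuous.continuousOn isClosed_univ hq0 hq
    (ae_of_all _ fun _ => mem_univ _) hci hHi
  have hpos : 0 < μ.real q := ENNReal.toReal_pos hq0 hq
  have h2 : ⨍ y in q, (c - f y) ∂μ = c - ⨍ y in q, f y ∂μ := by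
    rw [setAverage_eq, setAverage_eq, integral_sub (integrable_const c) hfi]
    simp only [integral_const, measureReal_restrict_apply_univ, smul_eq_mul]
    field_simp
  rw [h2, setAverage_eq μ fun y => H (c - f y), smul_eq_mul] at h1
  refine (ENNReal.ofReal_le_ofReal h1).trans ?_
  rw [ENNReal.ofReal_mul (by positivity), ENNReal.ofReal_inv_of_pos hpos,
    ofReal_integral_eq_lintegral_ofReal hHi (ae_of_all _ fun y => hH.nonneg _),
    Measure.real, ENNReal.ofReal_toReal hq]

/-- The average of `v` over the cell of index `z`. -/
noncomputable def cellAverage (h : ℝ) (v : EuclideanSpace ℝ (Fin N) → ℝ) (z : Fin N → ℤ) : ℝ :=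
  ⨍ y in cell h z, v y

lemma measurable_cellAverage (h : ℝ) (v : EuclideanSpace ℝ (Fin N) → ℝ) :
    Measurable fun x => cellAverage h v (cellIndex h x) :=
  (measurable_of_countable (cellAverage h v)).comp (measurable_cellIndex h)

lemma OrliczIntegrand.lintegral_enorm_le (hH : OrliczIntegrand H) {α : Type*}
    [MeasurableSpace α] {μ : Measure α} (f : α → ℝ) :
    ∫⁻ x, ‖f x‖ₑ ∂μ ≤ μ univ + ENNReal.ofReal (H 1)⁻¹ * ∫⁻ x, ENNReal.ofReal (H (f x)) ∂μ := by
  have h1 := hH.pos 1 one_ne_zero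
  calc ∫⁻ x, ‖f x‖ₑ ∂μ
      ≤ ∫⁻ x, (1 + ENNReal.ofReal (H 1)⁻¹ * ENNReal.ofReal (H (f x))) ∂μ := by
        refine lintegral_mono fun x => ?_
        rw [← ENNReal.ofReal_mul (by positivity), ← ENNReal.ofReal_one,
          ← ENNReal.ofReal_add zero_le_one (mul_nonneg (by positivity) (hH.nonneg _)),
          Real.enorm_eq_ofReal_abs]
        exact ENNReal.ofReal_le_ofReal (hH.abs_le _)
    _ = _ := by
        rw [lintegral_add_left measurable_const, lintegral_const_mul' _ _ ENNReal.ofReal_ne_top]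
        simp

/-- The distance in modular between a function and its cell averages is controlled by the
Gagliardo modular. -/
lemma OrliczIntegrand.modular_sub_cellAverage_le (hH : OrliczIntegrand H) (hs : 0 < s) {h : ℝ}
    (hh : 0 < h) (hh1 : h * √N ≤ 1) {v : EuclideanSpace ℝ (Fin N) → ℝ} (hv : Measurable v)
    (hvi : ∀ z, IntegrableOn v (cell h z)) :
    ∫⁻ x, ENNReal.ofReal (H (v x - cellAverage h v (cellIndex h x))) ≤
      ENNReal.ofReal ((h * √N) ^ s * √N ^ N) * ∫⁻ x, ∫⁻ y, gagliardoKernel s H v x y := by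
  have hρ : 0 ≤ (h * √N) ^ s := by positivity
  -- As `h √N ≤ 1`, convexity gives the factor `(h √N)^s`, which makes the error vanish with `h`.
  have hscale : ∀ t, H ((h * √N) ^ s * t) ≤ (h * √N) ^ s * H t := fun t =>
    hH.map_mul_le hρ (Real.rpow_le_one (by positivity) hh1 hs.le) t
  have hvol : ∀ z : Fin N → ℤ, volume (cell h z) ≠ 0 := fun z => by
    rw [volume_cell hh]; exact (ENNReal.ofReal_pos.2 (by positivity)).ne'
  have hconst : (ENNReal.ofReal (h ^ N))⁻¹ * ENNReal.ofReal ((h * √N) ^ s * (h * √N) ^ N) =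
      ENNReal.ofReal ((h * √N) ^ s * √N ^ N) := by
    rw [← ENNReal.ofReal_inv_of_pos (by positivity), ← ENNReal.ofReal_mul (by positivity)]
    congr 1
    rw [mul_pow h]; field_simp
  rw [← lintegral_const_mul' _ _ ENNReal.ofReal_ne_top]
  refine lintegral_mono fun x => ?_
  set z := cellIndex h x with hz
  calc ENNReal.ofReal (H (v x - cellAverage h v z))
      ≤ (volume (cell h z))⁻¹ * ∫⁻ y in cell h z, ENNReal.ofReal (H (v x - v y)) :=
        hH.ofReal_map_sub_average_le (hvol z) (by rw [volume_cell hh]; finiteness) hv (hvi z) _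
    _ ≤ (volume (cell h z))⁻¹ * ∫⁻ y in cell h z,
          ENNReal.ofReal ((h * √N) ^ s * (h * √N) ^ N) * gagliardoKernel s H v x y := by
        exact mul_le_mul' le_rfl (setLIntegral_mono' (measurableSet_cell h z) fun y hy =>
          hH.le_gagliardoKernel hs.le hρ hscale v (norm_sub_le_of_mem_cell hh hz.symm hy))
    _ ≤ (volume (cell h z))⁻¹ *
          (ENNReal.ofReal ((h * √N) ^ s * (h * √N) ^ N) * ∫⁻ y, gagliardoKernel s H v x y) := by
        rw [lintegral_const_mul' _ _ ENNReal.ofReal_ne_top]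
        gcongr
        exact Measure.restrict_le_self
    _ = _ := by rw [← mul_assoc, volume_cell hh, hconst]

/-- The sides of the cells used for approximation. -/
noncomputable def cellSide (m : ℕ) : ℝ := 1 / ((m : ℝ) + 1)

lemma cellSide_pos (m : ℕ) : 0 < cellSide m := by unfold cellSide; positivity

lemma tendsto_cellSide : Tendsto cellSide atTop (𝓝 0) := tendsto_one_div_add_atTop_nhds_zero_nat

lemma tendsto_cellSide_rpow (hs : 0 < s) {M : ℝ≥0∞} (hM : M ≠ ∞) :
    Tendsto (fun m : ℕ => ENNReal.ofReal ((cellSide m * √N) ^ s * √N ^ N) * M) atTop (𝓝 0) := by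
  have h1 : Tendsto (fun m : ℕ => (cellSide m * √N) ^ s * √N ^ N) atTop (𝓝 0) := by
    have h2 := (tendsto_cellSide.mul_const √N).rpow_const (p := s) (Or.inr hs.le)
    have h3 := h2.mul_const (√N ^ N)
    simpa [Real.zero_rpow hs.ne'] using h3
  have h2 := ENNReal.Tendsto.mul_const (b := M) (ENNReal.tendsto_ofReal h1) (Or.inr hM)
  simpa using h2

lemma OrliczIntegrand.exists_lintegral_cell_le (hH : OrliczIntegrand H)
    {v : ℕ → EuclideanSpace ℝ (Fin N) → ℝ}
    (hloc : ∀ R : ℝ, ∃ C : ℝ≥0∞, C ≠ ∞ ∧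
      ∀ n, ∫⁻ x in Metric.ball 0 R, ENNReal.ofReal (H (v n x)) ≤ C)
    {h : ℝ} (hh : 0 < h) (z : Fin N → ℤ) :
    ∃ C : ℝ≥0∞, C ≠ ∞ ∧ ∀ n, ∫⁻ x in cell h z, ‖v n x‖ₑ ≤ C := by
  obtain ⟨R, hR⟩ := (isBounded_cell hh z).subset_ball 0
  obtain ⟨C, hC, hCn⟩ := hloc R
  refine ⟨volume (Metric.ball (0 : EuclideanSpace ℝ (Fin N)) R) +
    ENNReal.ofReal (H 1)⁻¹ * C, ?_, fun n => ?_⟩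
  · have : volume (Metric.ball (0 : EuclideanSpace ℝ (Fin N)) R) ≠ ∞ := measure_ball_lt_top.ne
    finiteness
  · refine (lintegral_mono_set hR).trans ((hH.lintegral_enorm_le _).trans ?_)
    rw [Measure.restrict_apply_univ]
    gcongr
    exact hCn n

/-- Tychonoff replaces a diagonal argument: a countable product of intervals is compact and
metrizable, hence sequentially compact. -/
lemma exists_subseq_tendsto_pi {ι : Type*} [Countable ι] {x : ℕ → ι → ℝ}
    (hx : ∀ p, ∃ b : ℝ, ∀ n, x n p ∈ Icc (-b) b) :
    ∃ (a : ι → ℝ) (φ : ℕ → ℕ), StrictMono φ ∧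
      ∀ p, Tendsto (fun n => x (φ n) p) atTop (𝓝 (a p)) := by
  choose b hb using hx
  have hcomp : IsCompact (Set.univ.pi fun p => Icc (-b p) (b p)) :=
    isCompact_univ_pi fun p => isCompact_Icc
  obtain ⟨a, -, φ, hφ, hlim⟩ := hcomp.tendsto_subseq (x := x) fun n p _ => hb p n
  exact ⟨a, φ, hφ, fun p => tendsto_pi_nhds.1 hlim p⟩

/-- If the integrals over cells are bounded, then along a subsequence all the averages over cells
with sides `1 / (m + 1)` converge. -/
lemma exists_subseq_tendsto_cellAverage {v : ℕ → EuclideanSpace ℝ (Fin N) → ℝ}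
    (hint : ∀ m (z : Fin N → ℤ), ∃ C : ℝ≥0∞, C ≠ ∞ ∧
      ∀ n, ∫⁻ x in cell (cellSide m) z, ‖v n x‖ₑ ≤ C) :
    ∃ φ : ℕ → ℕ, StrictMono φ ∧ ∀ m z, ∃ a,
      Tendsto (fun n => cellAverage (cellSide m) (v (φ n)) z) atTop (𝓝 a) := by
  have hbound : ∀ p : ℕ × (Fin N → ℤ), ∃ b : ℝ, ∀ n, cellAverage (cellSide p.1) (v n) p.2 ∈
      Icc (-b) b := by
    intro p
    obtain ⟨C, hC, hCn⟩ := hint p.1 p.2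
    refine ⟨(volume.real (cell (cellSide p.1) p.2))⁻¹ * C.toReal, fun n => ?_⟩
    rw [mem_Icc, ← _root_.abs_le, cellAverage, setAverage_eq, smul_eq_mul, abs_mul,
      abs_of_nonneg (by positivity)]
    gcongr
    have := enorm_integral_le_lintegral_enorm (μ := volume.restrict (cell (cellSide p.1) p.2)) (v n)
    have h2 := ENNReal.toReal_mono hC (this.trans (hCn n))
    rwa [toReal_enorm, Real.norm_eq_abs] at h2
  obtain ⟨a, φ, hφ, hlim⟩ := exists_subseq_tendsto_pi hbound
  exact ⟨φ, hφ, fun m z => ⟨a (m, z), hlim (m, z)⟩⟩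

/-- If all cell averages converge, then the step functions of averages are Cauchy for the modular
on every ball. -/
lemma OrliczIntegrand.exists_cellAverage_cauchy (hH : OrliczIntegrand H) {h : ℝ} (hh : 0 < h)
    {w : ℕ → EuclideanSpace ℝ (Fin N) → ℝ}
    (hw : ∀ z, ∃ a, Tendsto (fun n => cellAverage h (w n) z) atTop (𝓝 a)) (R : ℝ) {ε : ℝ≥0∞}
    (hε : 0 < ε) : ∃ K, ∀ j ≥ K, ∀ k ≥ K, ∫⁻ x in Metric.ball 0 R, ENNReal.ofReal
      (H (cellAverage h (w j) (cellIndex h x) - cellAverage h (w k) (cellIndex h x))) ≤ ε := by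
  set B : Set (EuclideanSpace ℝ (Fin N)) := Metric.ball 0 R with hB
  have hBfin : volume B ≠ ∞ := measure_ball_lt_top.ne
  obtain ⟨η, hη, hηε⟩ : ∃ η : ℝ, 0 < η ∧ ENNReal.ofReal η * volume B ≤ ε := by
    have h1 : Tendsto (fun η : ℝ => ENNReal.ofReal η * volume B) (𝓝[>] 0) (𝓝 0) := by
      have h2 : Tendsto (fun η : ℝ => ENNReal.ofReal η) (𝓝[>] 0) (𝓝 0) := by
        simpa using (ENNReal.tendsto_ofReal (tendsto_id (α := ℝ) (x := 𝓝 0))).mono_left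
          nhdsWithin_le_nhds
      simpa using ENNReal.Tendsto.mul_const (b := volume B) h2 (Or.inr hBfin)
    obtain ⟨η, h2, h3⟩ := ((h1.eventually_le_const hε).and self_mem_nhdsWithin).exists
    exact ⟨η, h3, h2⟩
  -- Only finitely many cells meet the ball, so convergence of the averages is uniform there.
  have hev : ∀ᶠ p : ℕ × ℕ in atTop, ∀ z ∈ cellIndex h '' B,
      H (cellAverage h (w p.1) z - cellAverage h (w p.2) z) ≤ η := by
    rw [eventually_all_finite (finite_cellIndex_image hh Metric.isBounded_ball)]
    intro z _
    obtain ⟨a, ha⟩ := hw z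
    have h2 : Tendsto (fun p : ℕ × ℕ => H (cellAverage h (w p.1) z - cellAverage h (w p.2) z))
        atTop (𝓝 0) := by
      rw [← hH.map_zero, ← sub_self a, ← prod_atTop_atTop_eq]
      exact (hH.continuous.tendsto _).comp ((ha.comp tendsto_fst).sub (ha.comp tendsto_snd))
    exact h2.eventually_le_const hη
  obtain ⟨⟨K₁, K₂⟩, hK⟩ := eventually_atTop.1 hev
  refine ⟨max K₁ K₂, fun j hj k hk => le_trans ?_ hηε⟩
  have hjk := hK (j, k) ⟨(le_max_left _ _).trans hj, (le_max_right _ _).trans hk⟩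
  rw [← setLIntegral_const]
  exact setLIntegral_mono' Metric.isOpen_ball.measurableSet fun x hx =>
    ENNReal.ofReal_le_ofReal (hjk _ (mem_image_of_mem _ hx))

/-- A quasi-triangle inequality along `f, p, q, g`, meant for two functions and their step
approximations `p` and `q`. -/
lemma OrliczIntegrand.exists_lintegral_sub_le (hH : OrliczIntegrand H) :
    ∃ C : ℝ≥0∞, C ≠ ∞ ∧ ∀ {α : Type} [MeasurableSpace α] (μ : Measure α) {f g p q : α → ℝ},
      Measurable f → Measurable p → Measurable q →
      ∫⁻ x, ENNReal.ofReal (H (f x - g x)) ∂μ ≤ C * ((∫⁻ x, ENNReal.ofReal (H (f x - p x)) ∂μ) +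
        (∫⁻ x, ENNReal.ofReal (H (p x - q x)) ∂μ) + ∫⁻ x, ENNReal.ofReal (H (g x - q x)) ∂μ) := by
  obtain ⟨C, hC, hadd⟩ := hH.exists_ofReal_add_le
  refine ⟨C * (C + 1), by finiteness, fun {α} _ μ {f g p q} hf hp hq => ?_⟩
  have ha : Measurable fun x => ENNReal.ofReal (H (f x - p x)) :=
    hH.measurable_ofReal_comp (hf.sub hp)
  have hb : Measurable fun x => ENNReal.ofReal (H (p x - q x)) :=
    hH.measurable_ofReal_comp (hp.sub hq)
  have hab : Measurable fun x =>
      ENNReal.ofReal (H (f x - p x)) + ENNReal.ofReal (H (p x - q x)) := ha.add hb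
  rw [← lintegral_add_left ha, ← lintegral_add_left hab,
    ← lintegral_const_mul' _ _ (by finiteness)]
  refine lintegral_mono fun x => ?_
  have h1 := hadd (f x - p x) (p x - g x)
  have h2 := hadd (p x - q x) (q x - g x)
  rw [sub_add_sub_cancel] at h1 h2
  have h3 : H (q x - g x) = H (g x - q x) := by rw [← hH.map_abs, abs_sub_comm, hH.map_abs]
  rw [h3] at h2
  set a := ENNReal.ofReal (H (f x - p x))
  set b := ENNReal.ofReal (H (p x - q x))
  set c := ENNReal.ofReal (H (g x - q x))
  calc ENNReal.ofReal (H (f x - g x)) ≤ C * (a + C * (b + c)) := h1.trans (by gcongr)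
    -- The added term equalises the coefficients of `a`, `b` and `c` at `C * (C + 1)`.
    _ ≤ C * (a + C * (b + c)) + C * (C * a + (b + c)) := le_self_add
    _ = C * (C + 1) * (a + b + c) := by ring

/-- A sequence with bounded Gagliardo modulars and locally bounded modulars has a subsequence that
is Cauchy for the modular on every ball. -/
lemma OrliczIntegrand.exists_subseq_cauchy (hH : OrliczIntegrand H) (hs : 0 < s)
    {v : ℕ → EuclideanSpace ℝ (Fin N) → ℝ} (hv : ∀ n, Measurable (v n)) {M : ℝ≥0∞} (hM : M ≠ ∞)
    (hvM : ∀ n, ∫⁻ x, ∫⁻ y, gagliardoKernel s H (v n) x y ≤ M)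
    (hloc : ∀ R : ℝ, ∃ C : ℝ≥0∞, C ≠ ∞ ∧
      ∀ n, ∫⁻ x in Metric.ball 0 R, ENNReal.ofReal (H (v n x)) ≤ C) :
    ∃ φ : ℕ → ℕ, StrictMono φ ∧ ∀ (R : ℝ) (ε : ℝ≥0∞), 0 < ε → ∃ K, ∀ j ≥ K, ∀ k ≥ K,
      ∫⁻ x in Metric.ball 0 R, ENNReal.ofReal (H (v (φ j) x - v (φ k) x)) ≤ ε := by
  have hint := fun m (z : Fin N → ℤ) => hH.exists_lintegral_cell_le hloc (cellSide_pos m) z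
  have hvi : ∀ n m z, IntegrableOn (v n) (cell (cellSide m) z) := by
    intro n m z
    obtain ⟨C, hC, hCn⟩ := hint m z
    exact ⟨(hv n).aestronglyMeasurable, (hCn n).trans_lt hC.lt_top⟩
  obtain ⟨φ, hφ, hlim⟩ := exists_subseq_tendsto_cellAverage hint
  refine ⟨φ, hφ, fun R ε hε => ?_⟩
  obtain ⟨C, hC, hadd⟩ := hH.exists_lintegral_sub_le
  obtain ⟨ε', hε', hCε⟩ : ∃ ε' : ℝ≥0∞, 0 < ε' ∧ C * (ε' + ε' + ε') ≤ ε := by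
    have h1 : Tendsto (fun a : ℝ≥0∞ => C * (a + a + a)) (𝓝[>] 0) (𝓝 0) := by
      have h2 : Tendsto (fun a : ℝ≥0∞ => a) (𝓝[>] 0) (𝓝 0) := tendsto_id.mono_left
        nhdsWithin_le_nhds
      simpa using ENNReal.Tendsto.const_mul (a := C) ((h2.add h2).add h2) (Or.inr hC)
    obtain ⟨a, h2, h3⟩ := ((h1.eventually_le_const hε).and self_mem_nhdsWithin).exists
    exact ⟨a, h3, h2⟩
  -- The bound `M` makes one scale `m` serve all `n`.
  obtain ⟨m, hm1, hm⟩ : ∃ m, cellSide m * √N ≤ 1 ∧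
      ENNReal.ofReal ((cellSide m * √N) ^ s * √N ^ N) * M ≤ ε' := by
    have h1 : ∀ᶠ m in atTop, cellSide m * √N ≤ 1 := by
      have h2 := tendsto_cellSide.mul_const √N
      rw [zero_mul] at h2
      exact h2.eventually_le_const one_pos
    exact (h1.and ((tendsto_cellSide_rpow hs hM).eventually_le_const hε')).exists
  have hPe : ∀ n, ∫⁻ x in Metric.ball 0 R, ENNReal.ofReal (H (v n x -
      cellAverage (cellSide m) (v n) (cellIndex (cellSide m) x))) ≤ ε' := fun n =>
    (setLIntegral_le_lintegral _ _).trans ((hH.modular_sub_cellAverage_le hs (cellSide_pos m) hm1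
      (hv n) (hvi n m)).trans (le_trans (mul_le_mul' le_rfl (hvM n)) hm))
  obtain ⟨K, hK⟩ := hH.exists_cellAverage_cauchy (w := fun n => v (φ n)) (cellSide_pos m)
    (hlim m) R hε'
  refine ⟨K, fun j hj k hk => ?_⟩
  refine (hadd _ (hv (φ j)) (measurable_cellAverage (cellSide m) (v (φ j)))
    (measurable_cellAverage (cellSide m) (v (φ k)))).trans (le_trans ?_ hCε)
  exact mul_le_mul' le_rfl (add_le_add (add_le_add (hPe _) (hK j hj k hk)) (hPe _))

/-- Completeness: a sequence that is Cauchy for the modular on every ball converges for the modular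
on every ball. -/
lemma OrliczIntegrand.exists_limit_of_cauchy (hH : OrliczIntegrand H)
    {w : ℕ → EuclideanSpace ℝ (Fin N) → ℝ} (hw : ∀ n, Measurable (w n))
    (hc : ∀ (R : ℝ) (ε : ℝ≥0∞), 0 < ε → ∃ K, ∀ j ≥ K, ∀ k ≥ K,
      ∫⁻ x in Metric.ball 0 R, ENNReal.ofReal (H (w j x - w k x)) ≤ ε) :
    ∃ v : EuclideanSpace ℝ (Fin N) → ℝ, Measurable v ∧ ∀ R : ℝ,
      Tendsto (fun k => ∫⁻ x in Metric.ball 0 R, ENNReal.ofReal (H (w k x - v x))) atTop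
        (𝓝 0) := by
  have hpow : ∀ i : ℕ, 0 < ENNReal.ofReal (H ((1 / 2) ^ i)) := fun i =>
    ENNReal.ofReal_pos.2 (hH.pos _ (by positivity))
  -- By Chebyshev, this rate makes the set where the `i`-th increment reaches `2^{-i}` on the ball
  -- of radius `i` have measure at most `2^{-i}`. Since the radii grow, Borel-Cantelli gives a.e.
  -- convergence on the whole space along a single subsequence.
  obtain ⟨ψ, hψ, hψc⟩ := extraction_forall_of_eventually' (P := fun i k => ∀ j ≥ k,
      ∫⁻ x in Metric.ball 0 i, ENNReal.ofReal (H (w j x - w k x)) ≤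
        ENNReal.ofReal (H ((1 / 2) ^ i)) * (1 / 2) ^ i) (fun i => by
    obtain ⟨K, hK⟩ := hc i (ENNReal.ofReal (H ((1 / 2) ^ i)) * (1 / 2) ^ i)
      (ENNReal.mul_pos (hpow i).ne' (pow_ne_zero _ (by simp)))
    exact ⟨K, fun k hk j hj => hK j (hk.le.trans hj) k hk⟩)
  have hd : ∀ i, Measurable fun x => w (ψ (i + 1)) x - w (ψ i) x := fun i => (hw _).sub (hw _)
  set S : ℕ → Set (EuclideanSpace ℝ (Fin N)) := fun i =>
    {x | ENNReal.ofReal (H ((1 / 2) ^ i)) ≤ ENNReal.ofReal (H (w (ψ (i + 1)) x - w (ψ i) x))} ∩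
      Metric.ball 0 i with hS
  have hSm : ∀ i, volume (S i) ≤ (1 / 2) ^ i := by
    intro i
    have h1 := (mul_meas_ge_le_lintegral (μ := volume.restrict (Metric.ball 0 (i : ℝ)))
      (hH.measurable_ofReal_comp (hd i)) (ENNReal.ofReal (H ((1 / 2) ^ i)))).trans
      (hψc i _ (hψ.monotone i.le_succ))
    rw [Measure.restrict_apply (measurableSet_le measurable_const
      (hH.measurable_ofReal_comp (hd i)))] at h1
    exact (ENNReal.mul_le_mul_iff_right (hpow i).ne' ENNReal.ofReal_ne_top).1 h1
  have hsum : ∑' i, volume (S i) ≠ ∞ := by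
    refine ne_top_of_le_ne_top ?_ (ENNReal.tsum_le_tsum hSm)
    rw [ENNReal.tsum_geometric]
    simp
  have hlim : ∀ᵐ x : EuclideanSpace ℝ (Fin N), ∃ l, Tendsto (fun i => w (ψ i) x) atTop (𝓝 l) := by
    filter_upwards [ae_eventually_notMem hsum] with x hx
    refine cauchySeq_tendsto_of_complete (cauchySeq_of_summable_dist ?_)
    refine Summable.of_norm_bounded_eventually_nat
      (summable_geometric_of_lt_one (r := (1 / 2 : ℝ)) (by norm_num) (by norm_num)) ?_
    filter_upwards [hx, (tendsto_natCast_atTop_atTop (R := ℝ)).eventually_gt_atTop ‖x‖] with i hi hxi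
    have h1 : ENNReal.ofReal (H (w (ψ (i + 1)) x - w (ψ i) x)) <
        ENNReal.ofReal (H ((1 / 2) ^ i)) := by
      by_contra! hle
      exact hi ⟨hle, mem_ball_zero_iff.2 hxi⟩
    have h2 := (ENNReal.ofReal_lt_ofReal_iff (hH.pos _ (by positivity))).1 h1
    rw [Real.norm_of_nonneg dist_nonneg, dist_comm, Real.dist_eq]
    by_contra! hlt
    refine h2.not_ge (hH.mono _ _ ?_)
    rw [abs_of_pos (by positivity)]
    exact hlt.le
  obtain ⟨v, hv, hvlim⟩ := measurable_limit_of_tendsto_metrizable_ae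
    (fun i => (hw (ψ i)).aemeasurable) hlim
  refine ⟨v, hv, fun R => ?_⟩
  rw [ENNReal.tendsto_nhds_zero]
  intro ε hε
  obtain ⟨K, hK⟩ := hc R ε hε
  filter_upwards [eventually_ge_atTop K] with j hj
  -- Fatou along `ψ` carries the Cauchy estimate to the limit for the full sequence.
  calc ∫⁻ x in Metric.ball 0 R, ENNReal.ofReal (H (w j x - v x))
      = ∫⁻ x in Metric.ball 0 R,
          liminf (fun i => ENNReal.ofReal (H (w j x - w (ψ i) x))) atTop := by
        refine lintegral_congr_ae ?_
        filter_upwards [ae_restrict_of_ae hvlim] with x hx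
        exact (ENNReal.tendsto_ofReal ((hH.continuous.tendsto _).comp
          (hx.const_sub (w j x)))).liminf_eq.symm
    _ ≤ liminf (fun i => ∫⁻ x in Metric.ball 0 R,
          ENNReal.ofReal (H (w j x - w (ψ i) x))) atTop :=
        lintegral_liminf_le fun i => hH.measurable_ofReal_comp ((hw j).sub (hw (ψ i)))
    _ ≤ ε := by
        refine liminf_le_of_frequently_le' (Eventually.frequently ?_)
        filter_upwards [eventually_ge_atTop K] with i hi
        exact hK j hj _ (hi.trans (hψ.id_le i))

end Compactness

/-! ### Translation invariance, norm convergence and choice of the translations. -/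

section Translation

variable {N : ℕ} {H G : ℝ → ℝ} {s : ℝ}

lemma lintegral_gagliardoKernel_add_right (u : EuclideanSpace ℝ (Fin N) → ℝ)
    (p : EuclideanSpace ℝ (Fin N)) :
    ∫⁻ x, ∫⁻ y, gagliardoKernel s H (fun x => u (x + p)) x y =
      ∫⁻ x, ∫⁻ y, gagliardoKernel s H u x y := by
  have h1 : ∀ x y, gagliardoKernel s H (fun x => u (x + p)) x y =
      gagliardoKernel s H u (x + p) (y + p) := fun x y => by
    simp only [gagliardoKernel, holderQuotient, add_sub_add_right_eq_sub]
  simp only [h1]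
  rw [← lintegral_add_right_eq_self (μ := volume)
    (fun x => ∫⁻ y, gagliardoKernel s H u x y) p]
  exact lintegral_congr fun x =>
    lintegral_add_right_eq_self (μ := volume) (fun y => gagliardoKernel s H u (x + p) y) p

lemma lintegral_gagliardoKernel_congr {u w : EuclideanSpace ℝ (Fin N) → ℝ}
    (h : u =ᵐ[volume] w) :
    ∫⁻ x, ∫⁻ y, gagliardoKernel s H u x y = ∫⁻ x, ∫⁻ y, gagliardoKernel s H w x y := by
  refine lintegral_congr_ae ?_
  filter_upwards [h] with x hx
  refine lintegral_congr_ae ?_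
  filter_upwards [h] with y hy
  simp only [gagliardoKernel, holderQuotient, hx, hy]

/-- By doubling, the modular of `f k / c` is at most a constant, depending on `c`, times that of `f
k`; so it falls below `1` for every fixed `c`. -/
lemma OrliczIntegrand.tendsto_luxemburgNorm (hH : OrliczIntegrand fun t => G |t|)
    {Ω : Set (EuclideanSpace ℝ (Fin N))} {f : ℕ → EuclideanSpace ℝ (Fin N) → ℝ}
    (hf : Tendsto (fun k => orliczModular G Ω (f k)) atTop (𝓝 0)) :
    Tendsto (fun k => luxemburgNorm G Ω (f k)) atTop (𝓝 0) := by
  rw [ENNReal.tendsto_nhds_zero]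
  intro ε hε
  obtain ⟨c, hc, hcε⟩ : ∃ c : ℝ, 0 < c ∧ ENNReal.ofReal c ≤ ε := by
    obtain ⟨c, hc0, hc⟩ := ENNReal.lt_iff_exists_nnreal_btwn.1 hε
    exact ⟨c, by exact_mod_cast hc0, by simpa using hc.le⟩
  obtain ⟨C, hC, hscale⟩ := hH.exists_scaling c⁻¹
  have h1 := ENNReal.Tendsto.const_mul (a := ENNReal.ofReal C) hf (Or.inr ENNReal.ofReal_ne_top)
  rw [mul_zero] at h1
  filter_upwards [h1.eventually_le_const one_pos] with k hk
  refine le_trans (iInf_le_of_le c (iInf_le_of_le hc (iInf_le_of_le (le_trans ?_ hk) le_rfl))) hcε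
  rw [orliczModular, orliczModular, ← lintegral_const_mul' _ _ ENNReal.ofReal_ne_top]
  refine lintegral_mono fun x => ?_
  rw [← ENNReal.ofReal_mul hC, div_eq_inv_mul]
  exact ENNReal.ofReal_le_ofReal (hscale _)

lemma memOrliczLoc_of_modular_ball_ne_top {f v : EuclideanSpace ℝ (Fin N) → ℝ}
    (hv : Measurable v) (hfv : f =ᵐ[volume] v)
    (hfin : ∀ R : ℝ, ∫⁻ x in Metric.ball 0 R, ENNReal.ofReal (G |v x|) ≠ ∞) :
    MemOrliczLoc G f := by
  intro K hK
  refine ⟨(hv.aemeasurable.congr hfv.symm).restrict, 1, one_pos, ?_⟩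
  obtain ⟨R, hR⟩ := hK.isBounded.subset_ball 0
  refine lt_of_le_of_lt ?_ (hfin R).lt_top
  rw [orliczModular]
  refine le_trans (le_of_eq (lintegral_congr_ae ?_)) (lintegral_mono_set hR)
  filter_upwards [ae_restrict_of_ae hfv] with x hx
  rw [hx, one_mul]

/-- Chebyshev's inequality. The finiteness is qualitative, not uniform in the function, which is
enough for `exists_extremal_cell`. -/
lemma OrliczIntegrand.volume_lt_abs_ne_top (hH : OrliczIntegrand fun t => G |t|)
    {u w : EuclideanSpace ℝ (Fin N) → ℝ} (hw : Measurable w) (huw : u =ᵐ[volume] w)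
    (hu : MemOrlicz G univ u) {τ : ℝ} (hτ : 0 < τ) : volume {x | τ < |w x|} ≠ ∞ := by
  obtain ⟨-, c, hc, hfin⟩ := hu
  rw [orliczModular, Measure.restrict_univ, lintegral_congr_ae
    (g := fun x => ENNReal.ofReal (G |c * w x|)) (by filter_upwards [huw] with x hx; rw [hx])]
    at hfin
  have hpos : 0 < ENNReal.ofReal (G |c * τ|) := ENNReal.ofReal_pos.2 (hH.pos _ (by positivity))
  have h1 := (mul_meas_ge_le_lintegral (hH.measurable_ofReal_comp (hw.const_mul c))
    (ENNReal.ofReal (G |c * τ|))).trans_lt hfin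
  have h2 : volume {x | ENNReal.ofReal (G |c * τ|) ≤ ENNReal.ofReal (G |c * w x|)} ≠ ∞ := by
    intro htop
    rw [htop, ENNReal.mul_top hpos.ne'] at h1
    exact lt_irrefl _ h1
  refine ne_top_of_le_ne_top h2 (measure_mono fun x hx => ENNReal.ofReal_le_ofReal ?_)
  refine hH.mono _ _ ?_
  rw [abs_mul, abs_mul, abs_of_pos hτ]
  gcongr
  exact (show τ < |w x| from hx).le

/-- Under a bound on the Gagliardo modulars, sequences that do not vanish in measure can be
translated by lattice points so that, in a fixed ball and at some positive height, both the
superlevel sets and the sublevel sets have measure bounded below. -/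
lemma OrliczIntegrand.exists_translation (hH : OrliczIntegrand H) (hs : 0 < s) (hN : 1 ≤ N)
    {w : ℕ → EuclideanSpace ℝ (Fin N) → ℝ} (hw : ∀ n, Measurable (w n)) (M : ℝ)
    (hM : ∀ n, ∫⁻ x, ∫⁻ y, gagliardoKernel s H (w n) x y ≤ ENNReal.ofReal M)
    {τ δ : ℝ} (hτ : 0 < τ) (hδ : 0 < δ)
    (hmes : ∀ n, ENNReal.ofReal δ ≤ volume {x | τ < |w n x|})
    (hfin : ∀ n, volume {x | τ / 2 < |w n x|} ≠ ∞) :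
    ∃ (y : ℕ → Fin N → ℤ) (R : ℝ) (ε : ℝ≥0∞), ε ≠ 0 ∧ ∀ n,
      ε ≤ volume (Metric.ball 0 R ∩ {x | τ / 2 < |w n (x + latticePoint (y n))|}) ∧
      ε ≤ volume (Metric.ball 0 R ∩ {x | |w n (x + latticePoint (y n))| ≤ τ / 2}) := by
  obtain ⟨h, hh, hh1, hlt⟩ := hH.exists_small_side hs hN hτ hδ M
  have hcells : ∀ n, ∃ z z' : Fin N → ℤ, (∀ i, z i ≤ z' i ∧ z' i ≤ z i + 1) ∧
      ENNReal.ofReal (h ^ N / 2) ≤ volume (cell h z ∩ {x | τ / 2 < |w n x|}) ∧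
      ENNReal.ofReal (h ^ N / 2) ≤ volume (cell h z' \ {x | τ / 2 < |w n x|}) := by
    intro n
    obtain ⟨z₀, hz₀⟩ := hH.exists_cell_of_gagliardo_lt hs.le hN hh hτ (hw n)
      ((hM n).trans_lt (hlt.trans_le (mul_le_mul' le_rfl (hmes n))))
    exact exists_extremal_cell hN hh (measurableSet_lt measurable_const (hw n).abs) (hfin n) z₀ hz₀
  choose z z' hzz' hz hz' using hcells
  have hball : ∀ n (z'' : Fin N → ℤ), (∀ i, z n i ≤ z'' i ∧ z'' i ≤ z n i + 1) → ∀ x,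
      x + latticePoint (fun i => ⌊h * z n i⌋) ∈ cell h z'' →
      x ∈ Metric.ball (0 : EuclideanSpace ℝ (Fin N)) (3 * √N + 1) := by
    intro n z'' hz'' x hx
    rw [mem_ball_zero_iff]
    linarith [norm_le_mul_sqrt_of_abs_le (by norm_num)
      (abs_apply_le_of_add_latticePoint_mem_cell hh hh1 hz'' hx)]
  -- The corner `h z` of the full cell need not be integral, so its integer part serves as the
  -- translation.
  refine ⟨fun n i => ⌊h * z n i⌋, 3 * √N + 1, ENNReal.ofReal (h ^ N / 2),
    (ENNReal.ofReal_pos.2 (by positivity)).ne', fun n => ⟨?_, ?_⟩⟩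
  · refine (hz n).trans ?_
    rw [← measure_preimage_add_right volume (latticePoint fun i => ⌊h * z n i⌋)]
    exact measure_mono fun x hx => ⟨hball n (z n) (fun i => ⟨le_rfl, by omega⟩) x hx.1, hx.2⟩
  · refine (hz' n).trans ?_
    rw [← measure_preimage_add_right volume (latticePoint fun i => ⌊h * z n i⌋)]
    exact measure_mono fun x hx => ⟨hball n (z' n) (hzz' n) x hx.1, not_lt.1 (show ¬ τ / 2 < _ from hx.2)⟩

/-- The modular limit of functions that do not vanish in measure on a ball is non-trivial. -/
lemma OrliczIntegrand.not_ae_eq_zero_of_tendsto (hH : OrliczIntegrand H)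
    {w : ℕ → EuclideanSpace ℝ (Fin N) → ℝ} (hw : ∀ n, Measurable (w n))
    {v : EuclideanSpace ℝ (Fin N) → ℝ} {R τ : ℝ} {ε : ℝ≥0∞} (hτ : 0 < τ) (hε : ε ≠ 0)
    (hmes : ∀ n, ε ≤ volume (Metric.ball 0 R ∩ {x | τ < |w n x|}))
    (hlim : Tendsto (fun k => ∫⁻ x in Metric.ball 0 R, ENNReal.ofReal (H (w k x - v x))) atTop
      (𝓝 0)) : ¬ v =ᵐ[volume] 0 := by
  intro hv
  have hpos : 0 < ENNReal.ofReal (H τ) * ε :=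
    ENNReal.mul_pos (ENNReal.ofReal_pos.2 (hH.pos _ hτ.ne')).ne' hε
  obtain ⟨k, hk⟩ := (hlim.eventually_lt_const hpos).exists
  refine hk.not_ge ?_
  calc ENNReal.ofReal (H τ) * ε
      ≤ ∫⁻ _ in Metric.ball 0 R ∩ {x | τ < |w k x|}, ENNReal.ofReal (H τ) := by
        rw [setLIntegral_const]; gcongr; exact hmes k
    _ ≤ ∫⁻ x in Metric.ball 0 R ∩ {x | τ < |w k x|}, ENNReal.ofReal (H (w k x)) :=
        setLIntegral_mono' (Metric.isOpen_ball.measurableSet.inter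
          (measurableSet_lt measurable_const (hw k).abs)) fun x hx =>
          ENNReal.ofReal_le_ofReal (hH.mono _ _ (by
            rw [abs_of_pos hτ]; exact (show τ < |w k x| from hx.2).le))
    _ ≤ ∫⁻ x in Metric.ball 0 R, ENNReal.ofReal (H (w k x)) := lintegral_mono_set inter_subset_left
    _ = ∫⁻ x in Metric.ball 0 R, ENNReal.ofReal (H (w k x - v x)) := by
        refine lintegral_congr_ae ?_
        filter_upwards [ae_restrict_of_ae hv] with x hx
        rw [hx, Pi.zero_apply, sub_zero]

end Translation

/-! ### The main theorem. -/

theorem theorem1p5 {N : ℕ} (hN : 1 ≤ N) (s : ℝ) (hs0 : 0 < s) (hs1 : s < 1)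
    (G g : ℝ → ℝ) (hG : IsYoungFunction G g) (hGC1 : ContDiffOn ℝ 1 G (Set.Ici 0))
    (pm pp : ℝ) (hG1 : GrowthCondition G g pm pp)
    (u : ℕ → EuclideanSpace ℝ (Fin N) → ℝ)
    (hu : ∀ n, MemFracOrliczSobolev s G Set.univ (u n))
    (M : ℝ) (hM : ∀ n, gagliardoModular s G Set.univ (u n) ≤ ENNReal.ofReal M)
    (τ δ : ℝ) (hτ : 0 < τ) (hδ : 0 < δ)
    (hmes : ∀ n, ENNReal.ofReal δ ≤ volume {x : EuclideanSpace ℝ (Fin N) | τ < |u n x|}) :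
    ∃ y : ℕ → Fin N → ℤ, ∃ φ : ℕ → ℕ, StrictMono φ ∧
      ∃ v : EuclideanSpace ℝ (Fin N) → ℝ,
        TendstoOrliczLoc G (fun k x => u (φ k) (x + latticePoint (y (φ k)))) v ∧
        ¬ v =ᵐ[volume] 0 := by
  set H : ℝ → ℝ := fun t => G |t| with hHdef
  have hH : OrliczIntegrand H := hG.orliczIntegrand hGC1.continuousOn hG1
  have hum : ∀ n, AEMeasurable (u n) volume := fun n => by
    simpa [Measure.restrict_univ] using (hu n).1.1
  -- Measurable representatives; every quantity involved is insensitive to null sets.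
  set w : ℕ → EuclideanSpace ℝ (Fin N) → ℝ := fun n => (hum n).mk with hwdef
  have hw : ∀ n, Measurable (w n) := fun n => (hum n).measurable_mk
  have huw : ∀ n, u n =ᵐ[volume] w n := fun n => (hum n).ae_eq_mk
  have hwM : ∀ n, ∫⁻ x, ∫⁻ y, gagliardoKernel s H (w n) x y ≤ ENNReal.ofReal M := fun n => by
    rw [← lintegral_gagliardoKernel_congr (huw n), ← gagliardoModular_univ]
    exact hM n
  have hwmes : ∀ n, ENNReal.ofReal δ ≤ volume {x | τ < |w n x|} := fun n => by
    refine (hmes n).trans (measure_mono_ae ?_)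
    filter_upwards [huw n] with x hx hxτ
    have hxτ' : τ < |u n x| := hxτ
    rw [hx] at hxτ'
    exact hxτ'
  obtain ⟨y, R₀, ε, hε, hy⟩ := hH.exists_translation hs0 hN hw M hwM hτ hδ hwmes
    fun n => hH.volume_lt_abs_ne_top (hw n) (huw n) (hu n).1 (half_pos hτ)
  set v : ℕ → EuclideanSpace ℝ (Fin N) → ℝ := fun n x => w n (x + latticePoint (y n)) with hvdef
  have hv : ∀ n, Measurable (v n) := fun n => (hw n).comp (measurable_id.add_const _)
  have huv : ∀ n, (fun x => u n (x + latticePoint (y n))) =ᵐ[volume] v n := fun n =>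
    (measurePreserving_add_right volume (latticePoint (y n))).quasiMeasurePreserving.ae_eq_comp
      (huw n)
  have hvM : ∀ n, ∫⁻ x, ∫⁻ y, gagliardoKernel s H (v n) x y ≤ ENNReal.ofReal M := fun n =>
    (lintegral_gagliardoKernel_add_right (w n) _).trans_le (hwM n)
  have hloc : ∀ R : ℝ, ∃ C : ℝ≥0∞, C ≠ ∞ ∧
      ∀ n, ∫⁻ x in Metric.ball 0 R, ENNReal.ofReal (H (v n x)) ≤ C := by
    intro R
    -- The ball is enlarged to radius at least `R₀` so that it contains the set where `|v n| ≤ τ /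
    -- 2` is known to have measure at least `ε`.
    obtain ⟨C, hC, hCv⟩ := hH.exists_modular_ball_le (N := N) hs0.le
      (ENNReal.ofReal_ne_top (r := M)) hε (τ / 2) (max R R₀)
    refine ⟨C, hC, fun n => (lintegral_mono_set
      (Metric.ball_subset_ball (le_max_left R R₀))).trans (hCv (v n) (hv n) (hvM n) ?_)⟩
    exact (hy n).2.trans (measure_mono
      (inter_subset_inter_left _ (Metric.ball_subset_ball (le_max_right R R₀))))
  obtain ⟨φ, hφ, hcauchy⟩ := hH.exists_subseq_cauchy hs0 hv ENNReal.ofReal_ne_top hvM hloc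
  obtain ⟨V, hV, hlim⟩ := hH.exists_limit_of_cauchy (w := fun k => v (φ k)) (fun k => hv (φ k))
    hcauchy
  have hfin : ∀ n (R : ℝ), ∫⁻ x in Metric.ball 0 R, ENNReal.ofReal (H (v n x)) ≠ ∞ := by
    intro n R
    obtain ⟨C, hC, hCv⟩ := hloc R
    exact ne_top_of_le_ne_top hC (hCv n)
  refine ⟨y, φ, hφ, V, ⟨fun k => memOrliczLoc_of_modular_ball_ne_top (hv (φ k)) (huv (φ k))
    (hfin (φ k)), memOrliczLoc_of_modular_ball_ne_top hV (ae_eq_refl V) fun R => ?_,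
    fun K hK => hH.tendsto_luxemburgNorm ?_⟩,
    hH.not_ae_eq_zero_of_tendsto (fun k => hv (φ k)) (half_pos hτ) hε (fun k => (hy (φ k)).1)
      (hlim R₀)⟩
  -- The limit has finite modular on a ball because it is within modular distance `1` of some `v (φ
  -- k)`.
  · obtain ⟨C, hC, hadd⟩ := hH.exists_ofReal_add_le
    obtain ⟨k, hk⟩ := ((hlim R).eventually_lt_const one_pos).exists
    have hle : ∀ x, ENNReal.ofReal (H (V x)) ≤
        C * (ENNReal.ofReal (H (v (φ k) x - V x)) + ENNReal.ofReal (H (v (φ k) x))) := by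
      intro x
      have h1 := hadd (V x - v (φ k) x) (v (φ k) x)
      rwa [sub_add_cancel, ← hH.map_abs (V x - v (φ k) x), abs_sub_comm, hH.map_abs] at h1
    refine ne_top_of_le_ne_top ?_ (lintegral_mono hle)
    rw [lintegral_const_mul' _ _ hC,
      lintegral_add_right _ (hH.measurable_ofReal_comp (hv (φ k)))]
    exact ENNReal.mul_ne_top hC (ENNReal.add_ne_top.2 ⟨(hk.trans ENNReal.one_lt_top).ne,
      hfin (φ k) R⟩)
  · obtain ⟨R, hR⟩ := hK.isBounded.subset_ball 0
    refine tendsto_of_tendsto_of_tendsto_of_le_of_le tendsto_const_nhds (hlim R)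
      (fun _ => bot_le) fun k => ?_
    refine le_trans (le_of_eq (lintegral_congr_ae ?_)) (lintegral_mono_set hR)
    filter_upwards [ae_restrict_of_ae (huv (φ k))] with x hx
    simp only [hHdef]
    rw [hx]
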